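/- Let $\Delta E>0$, $n\in\mathbb N$ and $T\in(0,\infty]$ (with units such that $\hbar=k_B=1$ and with $1/\infty:=0$). Let $H_0:=\Delta E\cdot\operatorname{diag}(0,1,\dots,n-1)\in\mathbb C^{n\times n}$, and let $|1\rangle,\dots,|n\rangle$ be the standard basis of $\mathbb C^n$. Put $E_k:=(k-1)\Delta E$ and $$d_k:=\frac{e^{-E_k/T}}{\sum_{j=1}^n e^{-E_j/T}}\quad(1\le k\le n),\qquad \theta_k:=\arccos\Big(\big(1+\tfrac{d_{k+1}}{d_k}\big)^{-1/2}\Big)\quad(1\le k\le n-1),$$ $$\sigma_+^d:=\sum_{k=1}^{n-1}\sqrt{k(n-k)}\,\cos(\theta_k)\,|k\rangle\langle k+1|,\qquad \sigma_-^d:=\sum_{k=1}^{n-1}\sqrt{k(n-k)}\,\sin(\theta_k)\,|k+1\rangle\langle k|.$$ For $V\in\mathbb C^{n\times n}$ let $\mathbf\Gamma_V(\rho):=\tfrac12(V^\dagger V\rho+\rho V^\dagger V)-V\rho V^\dagger$, and let $\mathbf\Gamma_d:=\mathbf\Gamma_{\sigma_+^d}+\mathbf\Gamma_{\sigma_-^d}$.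 For $H\in\mathbb C^{n\times n}$ let $\operatorname{ad}_H(\rho):=H\rho-\rho H$. Let $\mathsf{TO}(H_0,T)$ be the set of thermal operations, i.e. of all linear maps on $\mathbb C^{n\times n}$ of the form $$\rho\mapsto\operatorname{tr}_B\Big(U\Big(\rho\otimes\frac{e^{-H_B/T}}{\operatorname{tr}(e^{-H_B/T})}\Big)U^\dagger\Big),$$ where $m\ge1$ is an integer, $H_B\in\mathbb C^{m\times m}$ is Hermitian, $U\in\mathbb C^{mn\times mn}$ is unitary with $U(H_0\otimes\mathbb 1+\mathbb 1\otimes H_B)U^\dagger=H_0\otimes\mathbb 1+\mathbb 1\otimes H_B$, and $\operatorname{tr}_B$ is the partial trace over the second tensor factor $\mathbb C^m$. Let $\overline{\mathsf{TO}(H_0,T)}$ be its closure in the finite-dimensional space of linear maps on $\mathbb C^{n\times n}$. Then for every Hermitian $H\in\mathbb C^{n\times n}$ with $[H,H_0]=0$ and every $t\ge0$, $$e^{-t(i\operatorname{ad}_H+\mathbf\Gamma_d)}\in\overline{\mathsf{TO}(H_0,T)}.$$ -/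

import Mathlib

open scoped ENNReal Kronecker

noncomputable section

namespace ThermalOps

/-- Complex `n × n` matrices. -/
abbrev Mat (n : ℕ) : Type := Matrix (Fin n) (Fin n) ℂ

/-- Linear operators acting on complex `n × n` matrices (all of them are continuous), with Mathlib's
topology on continuous linear maps. In this finite-dimensional situation it is the topology of any
operator norm. -/
abbrev SuperOp (n : ℕ) : Type := Mat n →L[ℂ] Mat n

theorem isTopologicalRing_of_normed (E : Type) [NormedAddCommGroup E] [NormedSpace ℂ E] :
    IsTopologicalRing (E →L[ℂ] E) := inferInstance

instance instIsTopologicalRingSuperOp (n : ℕ) : IsTopologicalRing (SuperOp n) :=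
  @isTopologicalRing_of_normed (Mat n) Matrix.normedAddCommGroup Matrix.normedSpace

/-- The inverse temperature `1 / T` of a temperature `T ∈ (0, ∞]` (Boltzmann constant one);
it is `0` for `T = ∞`. -/
def invTemp (T : ℝ≥0∞) : ℝ := (T⁻¹).toReal

theorem invTemp_ofReal {T : ℝ} (hT : 0 < T) : invTemp (ENNReal.ofReal T) = 1 / T := by
  simp [invTemp, hT.le]

theorem invTemp_top : invTemp ∞ = 0 := by simp [invTemp]

/-- The Gibbs state `e^{-H/T} / tr (e^{-H/T})` of a Hamiltonian `H` at temperature `T`. -/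
def gibbsState {m : ℕ} (H : Mat m) (T : ℝ≥0∞) : Mat m :=
  (NormedSpace.exp (-(invTemp T : ℂ) • H)).trace⁻¹ • NormedSpace.exp (-(invTemp T : ℂ) • H)

/-- The partial trace over the second tensor factor (the bath). -/
def partialTrace {n m : ℕ} (ρ : Matrix (Fin n × Fin m) (Fin n × Fin m) ℂ) : Mat n :=
  Matrix.of fun i j => ∑ k, ρ (i, k) (j, k)

/-- The defining property of the partial trace. -/
theorem trace_mul_partialTrace {n m : ℕ} (X : Mat n)
    (ρ : Matrix (Fin n × Fin m) (Fin n × Fin m) ℂ) :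
    (X * partialTrace ρ).trace = ((X ⊗ₖ (1 : Mat m)) * ρ).trace := by
  simp [Matrix.trace, Matrix.mul_apply, partialTrace, Fintype.sum_prod_type,
    Matrix.kroneckerMap_apply, Matrix.one_apply, Finset.mul_sum]
  exact Finset.sum_congr rfl fun i _ => Finset.sum_comm

/-- The total Hamiltonian `H₀ ⊗ 1 + 1 ⊗ H_B` of the uncoupled system and bath. -/
def uncoupled {n m : ℕ} (H₀ : Mat n) (HB : Mat m) :
    Matrix (Fin n × Fin m) (Fin n × Fin m) ℂ :=
  H₀ ⊗ₖ (1 : Mat m) + (1 : Mat n) ⊗ₖ HB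

/-- The thermal operations `TO(H₀, T)`: couple the system to a bath of finite dimension `m ≥ 1` in
its Gibbs state, apply a unitary that preserves the total energy, and trace out the bath. -/
def TO {n : ℕ} (H₀ : Mat n) (T : ℝ≥0∞) : Set (SuperOp n) :=
  {Φ | ∃ m : ℕ, 1 ≤ m ∧ ∃ HB : Mat m, HB.IsHermitian ∧
    ∃ U ∈ Matrix.unitaryGroup (Fin n × Fin m) ℂ,
      U * uncoupled H₀ HB * U.conjTranspose = uncoupled H₀ HB ∧
      ∀ ρ : Mat n, Φ ρ = partialTrace (U * (ρ ⊗ₖ gibbsState HB T) * U.conjTranspose)}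

/-- `ad_H = [H, ·]`. -/
def ad {n : ℕ} (H : Mat n) : SuperOp n :=
  LinearMap.toContinuousLinearMap (LinearMap.mulLeft ℂ H - LinearMap.mulRight ℂ H)

theorem ad_apply {n : ℕ} (H ρ : Mat n) : ad H ρ = H * ρ - ρ * H := rfl

/-- The GKSL dissipator `Γ_V` of a single operator `V`. -/
def dissipator {n : ℕ} (V : Mat n) : SuperOp n :=
  LinearMap.toContinuousLinearMap
    ((1 / 2 : ℂ) • (LinearMap.mulLeft ℂ (V.conjTranspose * V) +
        LinearMap.mulRight ℂ (V.conjTranspose * V)) -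
      LinearMap.mulLeft ℂ V ∘ₗ LinearMap.mulRight ℂ V.conjTranspose)

theorem dissipator_apply {n : ℕ} (V ρ : Mat n) :
    dissipator V ρ =
      (1 / 2 : ℂ) • (V.conjTranspose * V * ρ + ρ * (V.conjTranspose * V)) -
        V * ρ * V.conjTranspose := by
  rw [Matrix.mul_assoc V ρ]
  rfl

/-- The Gibbs vector `d` of the energies `E` at temperature `T`. -/
def gibbsVector {n : ℕ} (E : Fin n → ℝ) (T : ℝ≥0∞) (k : Fin n) : ℝ :=
  Real.exp (-invTemp T * E k) / ∑ j, Real.exp (-invTemp T * E j)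

/-- The thermal angle `arccos ((1 + b / a)^(-1/2))` of two Gibbs weights `a = d_k`,
`b = d_{k+1}`. -/
def thermalAngle (a b : ℝ) : ℝ := Real.arccos ((1 + b / a) ^ (-(1 / 2) : ℝ))

/-- The thermal lowering operator `σ₊ᵈ = ∑ₖ √(k (n - k)) cos θₖ |k⟩⟨k+1|`, `k = 1, …, n - 1`.
Rows and columns are numbered from `0`, so `|k⟩` is the basis vector with index `k - 1`. -/
def sigmaPlus {n : ℕ} (d : Fin n → ℝ) : Mat n :=
  Matrix.of fun i j =>
    if (j : ℕ) = i + 1 then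
      ((√((i + 1 : ℝ) * (n - (i + 1 : ℝ))) * Real.cos (thermalAngle (d i) (d j)) : ℝ) : ℂ)
    else 0

/-- The operator `σ₋ᵈ = ∑ₖ √(k (n - k)) sin θₖ |k+1⟩⟨k|`, `k = 1, …, n - 1`. -/
def sigmaMinus {n : ℕ} (d : Fin n → ℝ) : Mat n :=
  Matrix.of fun i j =>
    if (i : ℕ) = j + 1 then
      ((√((j + 1 : ℝ) * (n - (j + 1 : ℝ))) * Real.sin (thermalAngle (d j) (d i)) : ℝ) : ℂ)
    else 0

/-- The dissipator `Γ_d = Γ_{σ₊ᵈ} + Γ_{σ₋ᵈ}`. -/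
def ladderDissipator {n : ℕ} (d : Fin n → ℝ) : SuperOp n :=
  dissipator (sigmaPlus d) + dissipator (sigmaMinus d)

/-- The equidistant energies `0, ΔE, …, (n - 1) ΔE`. -/
def equidistant (n : ℕ) (ΔE : ℝ) (k : Fin n) : ℝ := k * ΔE

/-- The Hamiltonian `diag(0, …, n - 1) · ΔE`. -/
def ladderHamiltonian (n : ℕ) (ΔE : ℝ) : Mat n :=
  Matrix.diagonal fun k => (equidistant n ΔE k : ℂ)

end ThermalOps

end

/-! The semigroup is the limit of a collision model with a single type of bath: a qubit of gap `ΔE`,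
resonant with every rung of the ladder. Let `J` be the temperature-free lowering operator, `X = -i(J
⊗ |1⟩⟨0| + J† ⊗ |0⟩⟨1|)` and `Z = -iH ⊗ 1`. Both are anti-Hermitian and conserve the total energy,
so `U_s = exp(s²Z) exp(sX)` induces a thermal operation `Φ_s`.

Since `X` flips the qubit, the order-`s` term of `Φ_s` vanishes, and `Φ_s = 1 + s²G + o(s²)`, where
`-G` is `i ad_H` plus `Γ_J` and `Γ_{J†}` weighted by the Gibbs weights of the qubit
(`bathSandwich_qubitExchange_sq`). With `s = √(t/N)`, the powers `Φ_s^N` tend to `exp(tG)`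
(`tendsto_sesquilinear_exp_pow`). They are thermal because composition tensors the baths
(`IsBlockThermal.mul`).

Finally `cos²θ_k` and `sin²θ_k` are the same qubit weights for every `k`, as equal spacing makes
`d_{k+1}/d_k` constant; hence `-G = i ad_H + Γ_d` (`ladderDissipator_gibbsVector`). -/

open Filter Topology

/-! ### Second-order expansions of exponentials. -/

section ExpExpansion

variable {A : Type*} [NormedRing A] [NormedAlgebra ℝ A] [CompleteSpace A]

theorem tendsto_exp_smul_sub_one (x : A) :
    Tendsto (fun s : ℝ => s⁻¹ • (NormedSpace.exp (s • x) - 1)) (𝓝[≠] 0) (𝓝 x) := by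
  have h := (hasDerivAt_exp_smul_const x (0 : ℝ)).tendsto_slope_zero
  simpa using h

theorem tendsto_exp_smul_sub_one_sub (x : A) :
    Tendsto (fun s : ℝ => (s ^ 2)⁻¹ • (NormedSpace.exp (s • x) - 1 - s • x)) (𝓝[≠] 0)
      (𝓝 ((1 / 2 : ℝ) • x ^ 2)) := by
  have h : HasFPowerSeriesAt (NormedSpace.exp : A → A) (NormedSpace.expSeries ℝ A) 0 :=
    NormedSpace.exp_hasFPowerSeriesAt_zero
  have h3 := h.isBigO_sub_partialSum_pow 3
  have hs : Tendsto (fun s : ℝ => s • x) (𝓝[≠] 0) (𝓝 0) := by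
    have : Continuous fun s : ℝ => s • x := by fun_prop
    simpa using (this.tendsto 0).mono_left nhdsWithin_le_nhds
  have h4 := h3.comp_tendsto hs
  have key : (fun s : ℝ => (s ^ 2)⁻¹ • (NormedSpace.exp (s • x) - 1 - s • x) - (1 / 2 : ℝ) • x ^ 2)
      =O[𝓝[≠] 0] fun s : ℝ => s := by
    have h5 := (Asymptotics.isBigO_refl (fun s : ℝ => (s ^ 2)⁻¹) (𝓝[≠] 0)).smul h4
    refine (h5.congr' (g₂ := fun s : ℝ => ‖x‖ ^ 3 * |s|) ?_ ?_).trans ?_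
    · filter_upwards [self_mem_nhdsWithin] with s hs
      have hs : s ≠ 0 := hs
      simp only [Function.comp, zero_add, FormalMultilinearSeries.partialSum,
        Finset.sum_range_succ, NormedSpace.expSeries_apply_eq]
      simp [smul_pow, smul_sub, smul_smul]
      rw [mul_comm (2⁻¹ : ℝ), inv_mul_cancel_left₀ (pow_ne_zero 2 hs)]
      abel
    · filter_upwards [self_mem_nhdsWithin] with s hs
      have hs : s ≠ 0 := hs
      simp only [Function.comp, norm_smul, Real.norm_eq_abs, smul_eq_mul, ← sq_abs s]
      have : |s| ≠ 0 := by simpa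
      field_simp
    · exact (Asymptotics.isBigO_refl _ _).abs_left.const_mul_left _
  have hz : Tendsto (fun s : ℝ => s) (𝓝[≠] 0) (𝓝 0) := nhdsWithin_le_nhds
  have h6 := (key.trans_tendsto hz).add_const ((1 / 2 : ℝ) • x ^ 2)
  simpa using h6

/-- The product minus `1 + s • x` splits as `(exp(sx) - 1 - sx) + (exp(s²z) - 1) exp(sx)`, so `x`
and `z` need not commute. -/
theorem tendsto_exp_sq_smul_mul_exp_smul_sub (x z : A) :
    Tendsto (fun s : ℝ => (s ^ 2)⁻¹ • (NormedSpace.exp (s ^ 2 • z) * NormedSpace.exp (s • x) -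
      1 - s • x)) (𝓝[≠] 0) (𝓝 ((1 / 2 : ℝ) • x ^ 2 + z)) := by
  have hsq : Tendsto (fun s : ℝ => s ^ 2) (𝓝[≠] 0) (𝓝[≠] 0) := by
    refine tendsto_nhdsWithin_iff.2 ⟨?_, ?_⟩
    · have : Continuous fun s : ℝ => s ^ 2 := by fun_prop
      simpa using (this.tendsto 0).mono_left nhdsWithin_le_nhds
    · filter_upwards [self_mem_nhdsWithin] with s hs
      simpa using hs
  have h1 := (tendsto_exp_smul_sub_one z).comp hsq
  have h2 : Tendsto (fun s : ℝ => NormedSpace.exp (s • x)) (𝓝[≠] 0) (𝓝 1) := by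
    have h : ContinuousAt (fun s : ℝ => NormedSpace.exp (s • x)) 0 :=
      (hasDerivAt_exp_smul_const x (0 : ℝ)).continuousAt
    have h' := h.tendsto.mono_left (nhdsWithin_le_nhds (s := {0}ᶜ))
    simpa using h'
  have h3 := (tendsto_exp_smul_sub_one_sub x).add (h1.mul h2)
  rw [mul_one] at h3
  refine h3.congr fun s => ?_
  simp only [Function.comp, smul_mul_assoc, ← smul_add]
  congr 1
  noncomm_ring

end ExpExpansion

/-! ### Euler limits in a Banach algebra. -/

section PowExp

variable {A : Type*} [NormedRing A] [NormOneClass A]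

theorem norm_pow_sub_pow_le {a b : A} {M : ℝ} (hM : 1 ≤ M) (ha : ‖a‖ ≤ M) (hb : ‖b‖ ≤ M) (N : ℕ) :
    ‖a ^ N - b ^ N‖ ≤ N * M ^ N * ‖a - b‖ := by
  have hM0 : 0 ≤ M := zero_le_one.trans hM
  induction N with
  | zero => simp
  | succ k ih =>
    have e : a ^ (k + 1) - b ^ (k + 1) = a ^ k * (a - b) + (a ^ k - b ^ k) * b := by
      rw [pow_succ, pow_succ]; noncomm_ring
    have h1 : ‖a ^ k * (a - b)‖ ≤ M ^ (k + 1) * ‖a - b‖ := by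
      refine (norm_mul_le _ _).trans (mul_le_mul_of_nonneg_right ?_ (norm_nonneg _))
      calc ‖a ^ k‖ ≤ ‖a‖ ^ k := norm_pow_le _ _
        _ ≤ M ^ k := pow_le_pow_left₀ (norm_nonneg _) ha _
        _ ≤ M ^ (k + 1) := pow_le_pow_right₀ hM k.le_succ
    have h2 : ‖(a ^ k - b ^ k) * b‖ ≤ (k * M ^ k * ‖a - b‖) * M :=
      (norm_mul_le _ _).trans (mul_le_mul ih hb (norm_nonneg _) (by positivity))
    rw [e]
    refine (norm_add_le _ _).trans ((add_le_add h1 h2).trans_eq ?_)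
    push_cast
    ring

variable [NormedAlgebra ℝ A]

/-- Both bases eventually have norm at most `exp(C/N)`, so telescoping costs a factor `N exp(C)`,
whose `N` cancels the `N⁻¹` in the difference of the bases. -/
theorem tendsto_pow_sub_pow_zero {q r : ℕ → A} {L : A} (hq : Tendsto q atTop (𝓝 L))
    (hr : Tendsto r atTop (𝓝 L)) :
    Tendsto (fun N : ℕ => (1 + (N : ℝ)⁻¹ • q N) ^ N - (1 + (N : ℝ)⁻¹ • r N) ^ N) atTop (𝓝 0) := by
  set C : ℝ := ‖L‖ + 1
  have hC : 0 ≤ C := by positivity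
  have bound : ∀ x : A, ∀ N : ℕ, ‖x‖ ≤ C → ‖1 + (N : ℝ)⁻¹ • x‖ ≤ Real.exp ((N : ℝ)⁻¹ * C) := by
    intro x N hx
    calc ‖1 + (N : ℝ)⁻¹ • x‖ ≤ 1 + (N : ℝ)⁻¹ * ‖x‖ := by
          refine (norm_add_le _ _).trans ?_
          rw [norm_one, norm_smul, Real.norm_of_nonneg (by positivity)]
      _ ≤ 1 + (N : ℝ)⁻¹ * C := by gcongr
      _ ≤ _ := by rw [add_comm]; exact Real.add_one_le_exp _
  have ev : ∀ᶠ N : ℕ in atTop, ‖(1 + (N : ℝ)⁻¹ • q N) ^ N - (1 + (N : ℝ)⁻¹ • r N) ^ N‖ ≤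
      Real.exp C * ‖q N - r N‖ := by
    filter_upwards [hq.norm.eventually (ge_mem_nhds (lt_add_one ‖L‖)),
      hr.norm.eventually (ge_mem_nhds (lt_add_one ‖L‖)), eventually_gt_atTop 0] with N h1 h2 h3
    have hN : (N : ℝ) ≠ 0 := by positivity
    refine (norm_pow_sub_pow_le (Real.one_le_exp (by positivity)) (bound _ N h1)
      (bound _ N h2) N).trans_eq ?_
    rw [add_sub_add_left_eq_sub, ← smul_sub, norm_smul, Real.norm_of_nonneg (by positivity),
      ← Real.exp_nat_mul, mul_inv_cancel_left₀ hN]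
    field_simp
  refine squeeze_zero_norm' ev ?_
  simpa using ((hq.sub hr).norm).const_mul (Real.exp C)

theorem tendsto_one_add_inv_smul_pow_exp [CompleteSpace A] {q : ℕ → A} {L : A}
    (hq : Tendsto q atTop (𝓝 L)) :
    Tendsto (fun N : ℕ => (1 + (N : ℝ)⁻¹ • q N) ^ N) atTop (𝓝 (NormedSpace.exp L)) := by
  have hinv : Tendsto (fun N : ℕ => (N : ℝ)⁻¹) atTop (𝓝[≠] 0) :=
    tendsto_nhdsWithin_iff.2 ⟨tendsto_inv_atTop_nhds_zero_nat,
      (eventually_gt_atTop 0).mono fun N hN => by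
        simp [hN.ne']⟩
  -- The comparison sequence `N(exp(L/N) - 1)` is chosen so that its Euler power is exactly `exp L`.
  have h := tendsto_pow_sub_pow_zero hq ((tendsto_exp_smul_sub_one L).comp hinv)
  have h2 := h.add_const (NormedSpace.exp L)
  rw [zero_add] at h2
  refine h2.congr' ?_
  filter_upwards [eventually_gt_atTop 0] with N hN
  have hN' : (N : ℝ) ≠ 0 := by positivity
  have e : (1 + (N : ℝ)⁻¹ • ((fun s : ℝ => s⁻¹ • (NormedSpace.exp (s • L) - 1)) ∘
      fun N : ℕ => (N : ℝ)⁻¹) N) ^ N = NormedSpace.exp L := by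
    let : NormedAlgebra ℚ A := .restrictScalars ℚ ℝ A
    simp only [Function.comp]
    rw [smul_smul, inv_inv, inv_mul_cancel₀ hN', one_smul, add_sub_cancel, ← NormedSpace.exp_nsmul,
      ← Nat.cast_smul_eq_nsmul ℝ, smul_smul, mul_inv_cancel₀ hN', one_smul]
  rw [e, sub_add_cancel]

end PowExp


/-! ### Iterated sandwiches by a short-time evolution. -/

section Sesquilinear

variable {A W : Type*} [NormedRing A] [NormedAlgebra ℝ A] [CompleteSpace A] [NormedRing W]
  [NormOneClass W] [NormedAlgebra ℝ W] [CompleteSpace W]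

/-- `h₁` removes the order-`s` term and `h₂` identifies the order-`s²` term. Only real homogeneity
is asked of `S`, so that sandwiches conjugate-linear in the second slot qualify. -/
theorem tendsto_sesquilinear_exp_pow {S : A → A → W} (hS : Continuous fun p : A × A => S p.1 p.2)
    (add_left : ∀ u u' v, S (u + u') v = S u v + S u' v)
    (add_right : ∀ u v v', S u (v + v') = S u v + S u v')
    (smul_left : ∀ (s : ℝ) (u v), S (s • u) v = s • S u v)
    (smul_right : ∀ (s : ℝ) (u v), S u (s • v) = s • S u v) (one_one : S 1 1 = 1) {X Z : A} {G : W}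
    (h₁ : S X 1 + S 1 X = 0)
    (h₂ : S ((1 / 2 : ℝ) • X ^ 2 + Z) 1 + S 1 ((1 / 2 : ℝ) • X ^ 2 + Z) + S X X = G)
    {t : ℝ} (ht : 0 < t) :
    Tendsto (fun N : ℕ => S
      (NormedSpace.exp (√(t / N) ^ 2 • Z) * NormedSpace.exp (√(t / N) • X))
      (NormedSpace.exp (√(t / N) ^ 2 • Z) * NormedSpace.exp (√(t / N) • X)) ^ N) atTop
      (𝓝 (NormedSpace.exp (t • G))) := by
  set U : ℝ → A := fun s => NormedSpace.exp (s ^ 2 • Z) * NormedSpace.exp (s • X) with hU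
  set Y : ℝ → A := fun s => (s ^ 2)⁻¹ • (U s - 1 - s • X) with hY
  have hYlim : Tendsto Y (𝓝[≠] 0) (𝓝 ((1 / 2 : ℝ) • X ^ 2 + Z)) :=
    tendsto_exp_sq_smul_mul_exp_smul_sub X Z
  -- With `U = 1 + sX + s²Y`, this is exactly the part of `S U U` divisible by `s²`, once `h₁` is
  -- used.
  set Q : ℝ → W := fun s => S (Y s) 1 + S 1 (Y s) + S X X +
    s • (S X (Y s) + S (Y s) X) + s ^ 2 • S (Y s) (Y s) with hQ
  have hQlim : Tendsto Q (𝓝[≠] 0) (𝓝 G) := by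
    have hs : Tendsto (fun s : ℝ => s) (𝓝[≠] 0) (𝓝 0) := nhdsWithin_le_nhds
    have hS : ∀ {u v : ℝ → A} {u₀ v₀ : A}, Tendsto u (𝓝[≠] 0) (𝓝 u₀) →
        Tendsto v (𝓝[≠] 0) (𝓝 v₀) → Tendsto (fun s => S (u s) (v s)) (𝓝[≠] 0) (𝓝 (S u₀ v₀)) :=
      fun {u v u₀ v₀} hu hv => (hS.tendsto (u₀, v₀)).comp (hu.prodMk_nhds hv)
    have h := ((((hS hYlim (tendsto_const_nhds (x := 1))).add
      (hS (tendsto_const_nhds (x := 1)) hYlim)).add_const (S X X)).add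
      (hs.smul ((hS (tendsto_const_nhds (x := X)) hYlim).add
        (hS hYlim (tendsto_const_nhds (x := X)))))).add ((hs.pow 2).smul (hS hYlim hYlim))
    rw [h₂] at h
    simpa [hQ] using h
  have hexpand : ∀ s : ℝ, s ≠ 0 → S (U s) (U s) = 1 + s ^ 2 • Q s := by
    intro s hs
    have hUs : U s = 1 + s • X + s ^ 2 • Y s := by
      rw [hY]
      simp only [smul_smul, mul_inv_cancel₀ (pow_ne_zero 2 hs), one_smul]
      abel
    have h1 : S 1 X = -S X 1 := by
      rw [← add_eq_zero_iff_neg_eq.1 h₁]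
    rw [hUs, hQ]
    simp only [add_left, add_right, smul_left, smul_right, one_one, h1]
    module
  have hsN : Tendsto (fun N : ℕ => √(t / N)) atTop (𝓝[≠] 0) := by
    refine tendsto_nhdsWithin_iff.2 ⟨?_, ?_⟩
    · have h := (Real.continuous_sqrt.tendsto 0).comp (tendsto_const_div_atTop_nhds_zero_nat t)
      rwa [Real.sqrt_zero] at h
    · filter_upwards [eventually_gt_atTop 0] with N hN
      have : 0 < √(t / N) := by positivity
      exact this.ne'
  refine (tendsto_one_add_inv_smul_pow_exp ((hQlim.comp hsN).const_smul t)).congr' ?_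
  filter_upwards [eventually_gt_atTop 0] with N hN
  have hs : √(t / N) ≠ 0 := by positivity
  have h := hexpand _ hs
  rw [Real.sq_sqrt (by positivity), div_eq_inv_mul, ← smul_smul] at h
  simp only [Function.comp]
  rw [div_eq_inv_mul, ← h]

theorem tendsto_sesquilinear_exp_pow_clm {E : Type*} [NormedAddCommGroup E] [NormedSpace ℂ E]
    [CompleteSpace E] [Nontrivial E] {S : A → A → E →L[ℂ] E}
    (hS : Continuous fun p : A × A => S p.1 p.2)
    (add_left : ∀ u u' v, S (u + u') v = S u v + S u' v)
    (add_right : ∀ u v v', S u (v + v') = S u v + S u v')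
    (smul_left : ∀ (s : ℝ) (u v), S (s • u) v = (s : ℂ) • S u v)
    (smul_right : ∀ (s : ℝ) (u v), S u (s • v) = (s : ℂ) • S u v) (one_one : S 1 1 = 1) {X Z : A}
    {G : E →L[ℂ] E} (h₁ : S X 1 + S 1 X = 0)
    (h₂ : S ((1 / 2 : ℝ) • X ^ 2 + Z) 1 + S 1 ((1 / 2 : ℝ) • X ^ 2 + Z) + S X X = G)
    {t : ℝ} (ht : 0 < t) :
    Tendsto (fun N : ℕ => S
      (NormedSpace.exp (√(t / N) ^ 2 • Z) * NormedSpace.exp (√(t / N) • X))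
      (NormedSpace.exp (√(t / N) ^ 2 • Z) * NormedSpace.exp (√(t / N) • X)) ^ N) atTop
      (𝓝 (NormedSpace.exp ((t : ℂ) • G))) := by
  let : NormedAlgebra ℝ (E →L[ℂ] E) := NormedAlgebra.restrictScalars ℝ ℂ _
  exact tendsto_sesquilinear_exp_pow hS add_left add_right smul_left smul_right one_one h₁ h₂ ht

end Sesquilinear

/-! ### Thermal operations with diagonal baths, and their composition. -/

namespace ThermalOps

/-- The Gibbs weights of a finite family of energies at inverse temperature `β`. -/
noncomputable def gibbsWeight {ι : Type*} [Fintype ι] (β : ℝ) (e : ι → ℝ) (c : ι) : ℂ :=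
  ((Real.exp (-β * e c) / ∑ j, Real.exp (-β * e j) : ℝ) : ℂ)

theorem sum_gibbsWeight {ι : Type*} [Fintype ι] [Nonempty ι] (β : ℝ) (e : ι → ℝ) :
    ∑ c, gibbsWeight β e c = 1 := by
  have h : (0 : ℝ) < ∑ j, Real.exp (-β * e j) :=
    Finset.sum_pos (fun _ _ => Real.exp_pos _) Finset.univ_nonempty
  simp only [gibbsWeight]
  rw [← Complex.ofReal_sum, ← Finset.sum_div, div_self h.ne', Complex.ofReal_one]

theorem gibbsWeight_prod {ι κ : Type*} [Fintype ι] [Fintype κ] (β : ℝ) (e : ι → ℝ) (f : κ → ℝ)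
    (p : ι × κ) :
    gibbsWeight β (fun p : ι × κ => e p.1 + f p.2) p =
      gibbsWeight β e p.1 * gibbsWeight β f p.2 := by
  simp only [gibbsWeight]
  rw [← Complex.ofReal_mul, div_mul_div_comm, ← Real.exp_add, Finset.sum_mul_sum,
    Fintype.sum_prod_type]
  simp only [mul_add, Real.exp_add]

theorem gibbsState_diagonal {m : ℕ} (e : Fin m → ℝ) (T : ℝ≥0∞) :
    gibbsState (Matrix.diagonal fun k => (e k : ℂ)) T =
      Matrix.diagonal (gibbsWeight (invTemp T) e) := by
  have h : NormedSpace.exp (-(invTemp T : ℂ) • Matrix.diagonal fun k => (e k : ℂ)) =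
      Matrix.diagonal fun k => (Real.exp (-invTemp T * e k) : ℂ) := by
    rw [← Matrix.diagonal_smul, Matrix.exp_diagonal]
    congr 1
    funext k
    rw [Pi.coe_exp, ← Complex.exp_eq_exp_ℂ]
    simp
  rw [gibbsState, h, Matrix.trace_diagonal, ← Matrix.diagonal_smul]
  congr 1
  funext k
  simp only [gibbsWeight, Pi.smul_apply, smul_eq_mul]
  push_cast
  rw [div_eq_inv_mul]

/-- The thermal operations with a diagonal bath Hamiltonian of energies `e`, described by the
blocks `K a c` of the global unitary. -/
structure IsBlockThermal {n : ℕ} {ι : Type*} [Fintype ι] [DecidableEq ι] (H₀ : Mat n) (β : ℝ)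
    (e : ι → ℝ) (K : ι → ι → Mat n) (Φ : SuperOp n) : Prop where
  unitary : ∀ a b, ∑ c, K a c * (K b c).conjTranspose = if a = b then 1 else 0
  energy : ∀ a c, H₀ * K a c + (e a : ℂ) • K a c = K a c * H₀ + (e c : ℂ) • K a c
  apply : ∀ ρ, Φ ρ = ∑ a, ∑ c, gibbsWeight β e c • (K a c * ρ * (K a c).conjTranspose)

theorem isBlockThermal_one {n : ℕ} (H₀ : Mat n) (β : ℝ) :
    IsBlockThermal H₀ β (fun _ : Unit => 0) (fun _ _ => 1) 1 where
  unitary _ _ := by simp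
  energy _ _ := by simp
  apply ρ := by simp [gibbsWeight]

/-- The system meets two independent baths in turn: bath energies add, Gibbs weights factor, and the
blocks of the joint unitary multiply. -/
theorem IsBlockThermal.mul {n : ℕ} {ι κ : Type*} [Fintype ι] [DecidableEq ι] [Fintype κ]
    [DecidableEq κ] {H₀ : Mat n} {β : ℝ} {e : ι → ℝ} {f : κ → ℝ} {K : ι → ι → Mat n}
    {L : κ → κ → Mat n} {Φ Ψ : SuperOp n} (hΦ : IsBlockThermal H₀ β e K Φ)
    (hΨ : IsBlockThermal H₀ β f L Ψ) :
    IsBlockThermal H₀ β (fun p : κ × ι => f p.1 + e p.2) (fun p q => K p.2 q.2 * L p.1 q.1)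
      (Φ * Ψ) where
  unitary := by
    rintro ⟨a, b⟩ ⟨a', b'⟩
    rw [Fintype.sum_prod_type_right]
    have h : ∀ d, ∑ c, K b d * L a c * (K b' d * L a' c).conjTranspose =
        K b d * (if a = a' then 1 else 0) * (K b' d).conjTranspose := by
      intro d
      rw [← hΨ.unitary, Finset.mul_sum, Finset.sum_mul]
      simp only [Matrix.conjTranspose_mul, Matrix.mul_assoc]
    simp only [h]
    by_cases ha : a = a'
    · simp [ha, hΦ.unitary]
    · simp [ha]
  energy := by
    rintro ⟨a, b⟩ ⟨c, d⟩
    have h1 := congrArg (· * L a c) (hΦ.energy b d)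
    have h2 := congrArg (K b d * ·) (hΨ.energy a c)
    simp only [Matrix.add_mul, Matrix.mul_add, smul_mul_assoc, mul_smul_comm, Matrix.mul_assoc]
      at h1 h2 ⊢
    push_cast
    rw [add_smul, add_smul, add_left_comm, h1, add_left_comm, ← add_assoc, add_comm (_ • _), h2]
    abel
  apply ρ := by
    rw [mul_apply_eq_comp, hΦ.apply, hΨ.apply]
    simp only [Fintype.sum_prod_type, gibbsWeight_prod, Finset.mul_sum, Finset.sum_mul,
      Finset.smul_sum, Matrix.conjTranspose_mul, mul_smul_comm, smul_mul_assoc, smul_smul,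
      Matrix.mul_assoc]
    calc _ = ∑ b, ∑ a, ∑ d, ∑ c, (gibbsWeight β e d * gibbsWeight β f c) • (K b d * (L a c *
              (ρ * ((L a c).conjTranspose * (K b d).conjTranspose)))) :=
          Finset.sum_congr rfl fun b _ => Finset.sum_comm
      _ = _ := by
          rw [Finset.sum_comm]
          refine Finset.sum_congr rfl fun a _ => Finset.sum_congr rfl fun b _ => ?_
          rw [Finset.sum_comm]
          simp only [mul_comm (gibbsWeight β e _)]

theorem IsBlockThermal.reindex {n : ℕ} {ι κ : Type*} [Fintype ι] [DecidableEq ι] [Fintype κ]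
    [DecidableEq κ] {H₀ : Mat n} {β : ℝ} {e : ι → ℝ} {K : ι → ι → Mat n} {Φ : SuperOp n}
    (hΦ : IsBlockThermal H₀ β e K Φ) (σ : κ ≃ ι) :
    IsBlockThermal H₀ β (e ∘ σ) (fun a c => K (σ a) (σ c)) Φ where
  unitary a b := by
    rw [σ.sum_comp fun c => K (σ a) c * (K (σ b) c).conjTranspose, hΦ.unitary]
    simp
  energy a c := hΦ.energy _ _
  apply ρ := by
    have h : ∀ c, gibbsWeight β (e ∘ σ) c = gibbsWeight β e (σ c) := by
      intro c
      simp only [gibbsWeight, Function.comp]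
      rw [σ.sum_comp fun c => Real.exp (-β * e c)]
    simp only [h]
    rw [hΦ.apply, ← σ.sum_comp]
    refine Finset.sum_congr rfl fun a _ => ?_
    rw [← σ.sum_comp]

theorem IsBlockThermal.mem_TO {n m : ℕ} (hm : 1 ≤ m) {H₀ : Mat n} {T : ℝ≥0∞} {e : Fin m → ℝ}
    {K : Fin m → Fin m → Mat n} {Φ : SuperOp n} (hΦ : IsBlockThermal H₀ (invTemp T) e K Φ) :
    Φ ∈ TO H₀ T := by
  -- The blocks are glued with the bath index selecting the block; `unitary` then reads `U U† = 1`,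
  -- and `energy` is commutation with the total Hamiltonian.
  set U : Matrix (Fin n × Fin m) (Fin n × Fin m) ℂ := Matrix.of fun p q => K p.2 q.2 p.1 q.1
    with hU
  have hUU : U * U.conjTranspose = 1 := by
    ext ⟨i, a⟩ ⟨j, b⟩
    have h := congrFun (congrFun (hΦ.unitary a b) i) j
    simp only [Matrix.sum_apply, Matrix.mul_apply, Matrix.conjTranspose_apply] at h
    simp only [hU, Matrix.mul_apply, Matrix.conjTranspose_apply, Matrix.of_apply,
      Fintype.sum_prod_type_right, h, Matrix.one_apply, Prod.mk.injEq]
    by_cases hab : a = b <;> simp [hab, Matrix.one_apply]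
  have hcomm : U * uncoupled H₀ (Matrix.diagonal fun k => (e k : ℂ)) =
      uncoupled H₀ (Matrix.diagonal fun k => (e k : ℂ)) * U := by
    ext ⟨i, a⟩ ⟨j, b⟩
    have h := congrFun (congrFun (hΦ.energy a b) i) j
    simp only [Matrix.add_apply, Matrix.mul_apply, Matrix.smul_apply, smul_eq_mul] at h
    simp only [uncoupled, hU, Matrix.mul_apply, Matrix.of_apply, Fintype.sum_prod_type,
      Matrix.add_apply, Matrix.kroneckerMap_apply, Matrix.one_apply, Matrix.diagonal_apply]
    simp [mul_add, add_mul, Finset.sum_add_distrib]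
    rw [mul_comm _ (e b : ℂ), ← h]
  refine ⟨m, hm, Matrix.diagonal fun k => (e k : ℂ), ?_, U,
    Matrix.mem_unitaryGroup_iff.2 hUU, ?_, ?_⟩
  · rw [Matrix.isHermitian_diagonal_iff]
    intro k
    simp [IsSelfAdjoint]
  · rw [hcomm, Matrix.mul_assoc, hUU, Matrix.mul_one]
  · intro ρ
    rw [hΦ.apply, gibbsState_diagonal]
    ext i j
    simp only [partialTrace, Matrix.of_apply, Matrix.mul_apply, Fintype.sum_prod_type,
      Matrix.kroneckerMap_apply, Matrix.diagonal_apply, Matrix.conjTranspose_apply, hU,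
      Matrix.sum_apply, Matrix.smul_apply, smul_eq_mul]
    refine Finset.sum_congr rfl fun a _ => ?_
    rw [Finset.sum_comm]
    simp only [mul_ite, mul_zero, Finset.sum_ite_eq',
      Finset.mem_univ, if_true, Finset.sum_mul, Finset.mul_sum]
    refine Finset.sum_congr rfl fun c _ => Finset.sum_congr rfl fun k _ =>
      Finset.sum_congr rfl fun l _ => ?_
    ring

/-- The thermal operations with a bath whose Hamiltonian is diagonal. -/
def blockThermalSubmonoid {n : ℕ} (H₀ : Mat n) (β : ℝ) : Submonoid (SuperOp n) where
  carrier := {Φ | ∃ (ι : Type) (_ : Fintype ι) (_ : DecidableEq ι) (_ : Nonempty ι) (e : ι → ℝ)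
    (K : ι → ι → Mat n), IsBlockThermal H₀ β e K Φ}
  one_mem' := ⟨Unit, inferInstance, inferInstance, inferInstance, _, _, isBlockThermal_one H₀ β⟩
  mul_mem' := by
    rintro Φ Ψ ⟨ι, _, _, _, e, K, hΦ⟩ ⟨κ, _, _, _, f, L, hΨ⟩
    exact ⟨κ × ι, inferInstance, inferInstance, inferInstance, _, _, hΦ.mul hΨ⟩

theorem blockThermalSubmonoid_subset_TO {n : ℕ} (H₀ : Mat n) (T : ℝ≥0∞) :
    (blockThermalSubmonoid H₀ (invTemp T) : Set (SuperOp n)) ⊆ TO H₀ T := by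
  rintro Φ ⟨ι, _, _, _, e, K, hΦ⟩
  exact (hΦ.reindex (Fintype.equivFin ι).symm).mem_TO Fintype.card_pos

/-! ### Bath blocks and the limit theorem for repeated collisions. -/

variable {n m : ℕ}

/-- The block with bath indices `a`, `c` of a matrix on system and bath. -/
noncomputable def bathBlock (U : Matrix (Fin n × Fin m) (Fin n × Fin m) ℂ) (a c : Fin m) : Mat n :=
  U.submatrix (fun i => (i, a)) fun k => (k, c)

theorem bathBlock_add (U V : Matrix (Fin n × Fin m) (Fin n × Fin m) ℂ) (a c : Fin m) :
    bathBlock (U + V) a c = bathBlock U a c + bathBlock V a c := rfl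

theorem bathBlock_smul {R : Type*} [SMul R ℂ] (r : R)
    (U : Matrix (Fin n × Fin m) (Fin n × Fin m) ℂ) (a c : Fin m) :
    bathBlock (r • U) a c = r • bathBlock U a c := rfl

theorem bathBlock_one (a c : Fin m) :
    bathBlock (1 : Matrix (Fin n × Fin m) (Fin n × Fin m) ℂ) a c = if a = c then 1 else 0 := by
  ext i k
  by_cases h : a = c <;> simp [bathBlock, Matrix.one_apply, h]

theorem bathBlock_mul (U V : Matrix (Fin n × Fin m) (Fin n × Fin m) ℂ) (a c : Fin m) :
    bathBlock (U * V) a c = ∑ b, bathBlock U a b * bathBlock V b c := by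
  ext i k
  simp [bathBlock, Matrix.mul_apply, Matrix.sum_apply, Fintype.sum_prod_type_right]

theorem bathBlock_kronecker (A : Mat n) (B : Mat m) (a c : Fin m) :
    bathBlock (A ⊗ₖ B) a c = B a c • A := by
  ext i k
  simp [bathBlock, mul_comm]

@[fun_prop]
theorem continuous_bathBlock (a c : Fin m) :
    Continuous fun U : Matrix (Fin n × Fin m) (Fin n × Fin m) ℂ => bathBlock U a c :=
  continuous_id.matrix_submatrix _ _

/-- The map `ρ ↦ tr_B (U (ρ ⊗ diag γ) V†)`, written with the blocks of `U` and `V`. -/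
noncomputable def bathSandwich (γ : Fin m → ℂ)
    (U V : Matrix (Fin n × Fin m) (Fin n × Fin m) ℂ) : SuperOp n :=
  ∑ a, ∑ c, γ c • LinearMap.toContinuousLinearMap (LinearMap.mulLeft ℂ (bathBlock U a c) ∘ₗ
    LinearMap.mulRight ℂ (bathBlock V a c).conjTranspose)

theorem bathSandwich_apply (γ : Fin m → ℂ) (U V : Matrix (Fin n × Fin m) (Fin n × Fin m) ℂ)
    (ρ : Mat n) : bathSandwich γ U V ρ =
      ∑ a, ∑ c, γ c • (bathBlock U a c * ρ * (bathBlock V a c).conjTranspose) := by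
  simp only [bathSandwich, sum_apply, Matrix.mul_assoc]
  rfl

theorem continuous_bathSandwich (γ : Fin m → ℂ) :
    Continuous fun p : Matrix (Fin n × Fin m) (Fin n × Fin m) ℂ ×
      Matrix (Fin n × Fin m) (Fin n × Fin m) ℂ => bathSandwich γ p.1 p.2 := by
  have h : ∀ ρ, Continuous fun p : Matrix (Fin n × Fin m) (Fin n × Fin m) ℂ ×
      Matrix (Fin n × Fin m) (Fin n × Fin m) ℂ => bathSandwich γ p.1 p.2 ρ := by
    intro ρ
    simp only [bathSandwich_apply]
    fun_prop
  let : NormedAddCommGroup (Mat n) := Matrix.normedAddCommGroup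
  let : NormedSpace ℂ (Mat n) := Matrix.normedSpace
  exact continuous_clm_apply.2 h

theorem bathSandwich_add_left (γ : Fin m → ℂ)
    (U U' V : Matrix (Fin n × Fin m) (Fin n × Fin m) ℂ) :
    bathSandwich γ (U + U') V = bathSandwich γ U V + bathSandwich γ U' V := by
  ext1 ρ
  simp only [bathSandwich_apply, bathBlock_add, add_apply, Matrix.add_mul,
    smul_add, Finset.sum_add_distrib]

theorem bathSandwich_add_right (γ : Fin m → ℂ)
    (U V V' : Matrix (Fin n × Fin m) (Fin n × Fin m) ℂ) :
    bathSandwich γ U (V + V') = bathSandwich γ U V + bathSandwich γ U V' := by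
  ext1 ρ
  simp only [bathSandwich_apply, bathBlock_add, add_apply, Matrix.mul_add,
    Matrix.conjTranspose_add, smul_add, Finset.sum_add_distrib]

theorem bathSandwich_smul_left (γ : Fin m → ℂ) (s : ℝ)
    (U V : Matrix (Fin n × Fin m) (Fin n × Fin m) ℂ) :
    bathSandwich γ (s • U) V = (s : ℂ) • bathSandwich γ U V := by
  ext1 ρ
  simp only [bathSandwich_apply, bathBlock_smul, smul_apply,
    smul_mul_assoc, Finset.smul_sum, ← Complex.coe_smul s, smul_comm (s : ℂ)]

theorem bathSandwich_smul_right (γ : Fin m → ℂ) (s : ℝ)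
    (U V : Matrix (Fin n × Fin m) (Fin n × Fin m) ℂ) :
    bathSandwich γ U (s • V) = (s : ℂ) • bathSandwich γ U V := by
  ext1 ρ
  simp only [bathSandwich_apply, bathBlock_smul, smul_apply,
    Matrix.conjTranspose_smul, mul_smul_comm, Finset.smul_sum,
    Complex.star_def, Complex.conj_ofReal, ← Complex.coe_smul s, smul_comm (s : ℂ)]

theorem bathSandwich_one_one (γ : Fin m → ℂ) (hγ : ∑ c, γ c = 1) :
    bathSandwich γ 1 1 = (1 : SuperOp n) := by
  ext1 ρ
  simp [bathSandwich_apply, bathBlock_one, apply_ite, ite_mul, ← Finset.sum_smul, hγ]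

theorem isBlockThermal_bathSandwich {H₀ : Mat n} (β : ℝ) {e : Fin m → ℝ}
    {U : Matrix (Fin n × Fin m) (Fin n × Fin m) ℂ} (hU : U * U.conjTranspose = 1)
    (hcomm : Commute (uncoupled H₀ (Matrix.diagonal fun k => (e k : ℂ))) U) :
    IsBlockThermal H₀ β e (bathBlock U) (bathSandwich (gibbsWeight β e) U U) where
  unitary a b := by
    rw [← bathBlock_one, ← hU, bathBlock_mul]
    rfl
  energy a c := by
    have h := congrArg (fun M => bathBlock M a c) hcomm.eq
    simpa [bathBlock_mul, uncoupled, bathBlock_add, bathBlock_kronecker, Matrix.add_mul,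
      Matrix.mul_add, Matrix.one_apply, Matrix.diagonal_apply, Finset.sum_add_distrib] using h
  apply ρ := bathSandwich_apply _ _ _ _

/-- Anti-Hermitian exponents commuting with the total Hamiltonian give energy-preserving unitaries,
so each collision is thermal, and so are its powers; only the limit needs the closure. -/
theorem exp_mem_closure_of_bath [NeZero n] [NeZero m] {H₀ : Mat n} {T : ℝ≥0∞} {e : Fin m → ℝ}
    {X Z : Matrix (Fin n × Fin m) (Fin n × Fin m) ℂ} (hX : X.conjTranspose = -X)
    (hZ : Z.conjTranspose = -Z)
    (hXc : Commute (uncoupled H₀ (Matrix.diagonal fun k => (e k : ℂ))) X)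
    (hZc : Commute (uncoupled H₀ (Matrix.diagonal fun k => (e k : ℂ))) Z)
    {G : SuperOp n}
    (h₁ : bathSandwich (gibbsWeight (invTemp T) e) X 1 +
      bathSandwich (gibbsWeight (invTemp T) e) 1 X = 0)
    (h₂ : bathSandwich (gibbsWeight (invTemp T) e) ((1 / 2 : ℝ) • X ^ 2 + Z) 1 +
      bathSandwich (gibbsWeight (invTemp T) e) 1 ((1 / 2 : ℝ) • X ^ 2 + Z) +
      bathSandwich (gibbsWeight (invTemp T) e) X X = G) {t : ℝ} (ht : 0 < t) :
    NormedSpace.exp ((t : ℂ) • G) ∈ closure (TO H₀ T) := by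
  set γ := gibbsWeight (invTemp T) e with hγ
  have hexp : ∀ {Y : Matrix (Fin n × Fin m) (Fin n × Fin m) ℂ}, Y.conjTranspose = -Y →
      NormedSpace.exp Y * (NormedSpace.exp Y).conjTranspose = 1 := by
    intro Y hY
    rw [← Matrix.exp_conjTranspose, hY, ← Matrix.exp_add_of_commute _ _ (Commute.refl Y).neg_right,
      add_neg_cancel, NormedSpace.exp_zero]
  have hmem : ∀ s : ℝ, bathSandwich γ (NormedSpace.exp (s ^ 2 • Z) * NormedSpace.exp (s • X))
      (NormedSpace.exp (s ^ 2 • Z) * NormedSpace.exp (s • X)) ∈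
        blockThermalSubmonoid H₀ (invTemp T) := by
    intro s
    refine ⟨Fin m, inferInstance, inferInstance, inferInstance, e, _,
      isBlockThermal_bathSandwich _ ?_ ?_⟩
    · have h1 : NormedSpace.exp (s ^ 2 • Z) * (NormedSpace.exp (s ^ 2 • Z)).conjTranspose = 1 :=
        hexp (by simp [hZ, Matrix.conjTranspose_smul])
      have h2 : NormedSpace.exp (s • X) * (NormedSpace.exp (s • X)).conjTranspose = 1 :=
        hexp (by simp [hX, Matrix.conjTranspose_smul])
      rw [Matrix.conjTranspose_mul, Matrix.mul_assoc, ← Matrix.mul_assoc (NormedSpace.exp (s • X)),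
        h2, Matrix.one_mul, h1]
    · exact ((hZc.smul_right _).exp_right).mul_right ((hXc.smul_right _).exp_right)
  have hlim : Tendsto (fun N : ℕ => bathSandwich γ
      (NormedSpace.exp (√(t / N) ^ 2 • Z) * NormedSpace.exp (√(t / N) • X))
      (NormedSpace.exp (√(t / N) ^ 2 • Z) * NormedSpace.exp (√(t / N) • X)) ^ N) atTop
      (𝓝 (NormedSpace.exp ((t : ℂ) • G))) := by
    let : NormedAddCommGroup (Mat n) := Matrix.normedAddCommGroup
    let : NormedSpace ℂ (Mat n) := Matrix.normedSpace
    have : CompleteSpace (Mat n) := FiniteDimensional.complete ℂ _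
    let : NormedRing (Matrix (Fin n × Fin m) (Fin n × Fin m) ℂ) := Matrix.linftyOpNormedRing
    let : NormedAlgebra ℝ (Matrix (Fin n × Fin m) (Fin n × Fin m) ℂ) :=
      Matrix.linftyOpNormedAlgebra
    exact tendsto_sesquilinear_exp_pow_clm (A := Matrix (Fin n × Fin m) (Fin n × Fin m) ℂ)
      (E := Mat n) (continuous_bathSandwich γ)
      (bathSandwich_add_left γ) (bathSandwich_add_right γ) (bathSandwich_smul_left γ)
      (bathSandwich_smul_right γ) (bathSandwich_one_one γ (sum_gibbsWeight _ _)) h₁ h₂ ht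
  exact mem_closure_of_tendsto hlim
    (Eventually.of_forall fun N => blockThermalSubmonoid_subset_TO H₀ T (pow_mem (hmem _) N))

theorem commute_uncoupled_of_bathBlock {H₀ : Mat n} {e : Fin m → ℝ}
    {U : Matrix (Fin n × Fin m) (Fin n × Fin m) ℂ}
    (h : ∀ a c, H₀ * bathBlock U a c + (e a : ℂ) • bathBlock U a c =
      bathBlock U a c * H₀ + (e c : ℂ) • bathBlock U a c) :
    Commute (uncoupled H₀ (Matrix.diagonal fun k => (e k : ℂ))) U := by
  have hb : ∀ a c, bathBlock (uncoupled H₀ (Matrix.diagonal fun k => (e k : ℂ)) * U) a c =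
      bathBlock (U * uncoupled H₀ (Matrix.diagonal fun k => (e k : ℂ))) a c := by
    intro a c
    simpa [bathBlock_mul, uncoupled, bathBlock_add, bathBlock_kronecker, Matrix.add_mul,
      Matrix.mul_add, Matrix.one_apply, Matrix.diagonal_apply, Finset.sum_add_distrib] using h a c
  ext ⟨i, a⟩ ⟨k, c⟩
  exact congrFun (congrFun (hb a c) i) k

/-! ### The resonant qubit collision. -/

/-- The resonant exchange interaction of a lowering operator `J` with a qubit, times `-i`. -/
noncomputable def qubitExchange (J : Mat n) : Matrix (Fin n × Fin 2) (Fin n × Fin 2) ℂ :=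
  J ⊗ₖ !![0, 0; -Complex.I, 0] + J.conjTranspose ⊗ₖ !![0, -Complex.I; 0, 0]

theorem conjTranspose_qubitExchange (J : Mat n) :
    (qubitExchange J).conjTranspose = -qubitExchange J := by
  ext ⟨i, a⟩ ⟨k, c⟩
  fin_cases a <;> fin_cases c <;> simp [qubitExchange]

/-- The energies `0`, `ΔE` of the bath qubit. -/
def qubitEnergy (ΔE : ℝ) : Fin 2 → ℝ := ![0, ΔE]

/-- `hJ` says that `J` lowers the system energy by `ΔE`, exactly what the qubit gains; the adjoint
term is the reverse exchange. -/
theorem commute_qubitExchange {H₀ J : Mat n} (hH₀ : H₀.IsHermitian) {ΔE : ℝ}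
    (hJ : H₀ * J + (ΔE : ℂ) • J = J * H₀) :
    Commute (uncoupled H₀ (Matrix.diagonal fun k => (qubitEnergy ΔE k : ℂ)))
      (qubitExchange J) := by
  have hJ' : H₀ * J.conjTranspose = J.conjTranspose * H₀ + (ΔE : ℂ) • J.conjTranspose := by
    have h := congrArg Matrix.conjTranspose hJ
    simp only [Matrix.conjTranspose_add, Matrix.conjTranspose_mul, Matrix.conjTranspose_smul,
      hH₀.eq, Complex.star_def, Complex.conj_ofReal] at h
    exact h.symm
  refine commute_uncoupled_of_bathBlock fun a c => ?_
  fin_cases a <;> fin_cases c <;>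
    simp [qubitExchange, qubitEnergy, bathBlock_add, bathBlock_kronecker, ← hJ, hJ', smul_add,
      smul_comm (ΔE : ℂ), add_comm]

/-- The exchange has only off-diagonal bath blocks and the identity only diagonal ones, so each
summand vanishes separately. -/
theorem bathSandwich_qubitExchange_add (γ : Fin 2 → ℂ) (J : Mat n) :
    bathSandwich γ (qubitExchange J) 1 + bathSandwich γ 1 (qubitExchange J) = 0 := by
  ext1 ρ
  simp [bathSandwich_apply, qubitExchange, bathBlock_add, bathBlock_kronecker, bathBlock_one]

/-- The square has diagonal blocks `-J†J` and `-JJ†`, which give the anticommutators; the blocks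
`-iJ` and `-iJ†` give the jump terms `JρJ†` and `J†ρJ`, with weights `γ 0` and `γ 1`. Normalization
of `γ` makes `Z` contribute all of `-i ad_H`. -/
theorem bathSandwich_qubitExchange_sq (γ : Fin 2 → ℝ) (hγ : ∑ c, γ c = 1) (J : Mat n) {H : Mat n}
    (hH : H.IsHermitian) {Z : Matrix (Fin n × Fin 2) (Fin n × Fin 2) ℂ}
    (hZ : Z = (-Complex.I • H) ⊗ₖ 1) :
    bathSandwich (fun c => (γ c : ℂ)) ((1 / 2 : ℝ) • qubitExchange J ^ 2 + Z) 1 +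
      bathSandwich (fun c => (γ c : ℂ)) 1 ((1 / 2 : ℝ) • qubitExchange J ^ 2 + Z) +
      bathSandwich (fun c => (γ c : ℂ)) (qubitExchange J) (qubitExchange J) =
    -(Complex.I • ad H + ((γ 0 : ℂ) • dissipator J + (γ 1 : ℂ) • dissipator J.conjTranspose)) := by
  have h1 : (γ 1 : ℂ) = 1 - γ 0 := by
    rw [Fin.sum_univ_two] at hγ
    rw [eq_sub_iff_add_eq, add_comm]
    exact_mod_cast hγ
  ext1 ρ
  subst hZ
  simp [bathSandwich_apply, qubitExchange, bathBlock_add, bathBlock_kronecker, bathBlock_one,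
    bathBlock_smul, bathBlock_mul, sq, ad_apply, dissipator_apply, Matrix.one_apply, hH.eq]
  simp only [← Complex.coe_smul, h1]
  simp [smul_smul, Matrix.add_mul, Matrix.mul_add, Matrix.mul_assoc]
  module

/-! ### The equidistant ladder and its thermal angles. -/

/-- The lowering operator `∑ₖ √(k (n - k)) |k⟩⟨k+1|`. -/
noncomputable def ladderLowering (n : ℕ) : Mat n :=
  Matrix.of fun i j =>
    if (j : ℕ) = i + 1 then ((√((i + 1 : ℝ) * (n - (i + 1 : ℝ))) : ℝ) : ℂ) else 0

theorem ladderHamiltonian_isHermitian (n : ℕ) (ΔE : ℝ) : (ladderHamiltonian n ΔE).IsHermitian := by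
  rw [ladderHamiltonian, Matrix.isHermitian_diagonal_iff]
  intro k
  simp [IsSelfAdjoint]

theorem ladderHamiltonian_mul_lowering (n : ℕ) (ΔE : ℝ) :
    ladderHamiltonian n ΔE * ladderLowering n + (ΔE : ℂ) • ladderLowering n =
      ladderLowering n * ladderHamiltonian n ΔE := by
  ext i j
  simp only [ladderHamiltonian, ladderLowering, Matrix.add_apply, Matrix.diagonal_mul,
    Matrix.mul_diagonal, Matrix.smul_apply, Matrix.of_apply, smul_eq_mul, equidistant]
  split_ifs with h
  · rw [h]; push_cast; ring
  · simp

/-- Equal spacing gives every rung the Boltzmann factor of one and the same qubit. -/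
theorem gibbsVector_equidistant_div {n : ℕ} (ΔE : ℝ) (T : ℝ≥0∞) {i j : Fin n}
    (h : (j : ℕ) = i + 1) :
    gibbsVector (equidistant n ΔE) T j / gibbsVector (equidistant n ΔE) T i =
      Real.exp (-invTemp T * ΔE) := by
  have hZ : (0 : ℝ) < ∑ j, Real.exp (-invTemp T * equidistant n ΔE j) :=
    Finset.sum_pos (fun _ _ => Real.exp_pos _) ⟨i, Finset.mem_univ i⟩
  rw [gibbsVector, gibbsVector, div_div_div_cancel_right₀ hZ.ne', ← Real.exp_sub]
  congr 1
  simp only [equidistant, h]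
  push_cast
  ring

theorem cos_thermalAngle {a b q : ℝ} (hq : 0 ≤ q) (h : b / a = q) :
    Real.cos (thermalAngle a b) = √(1 / (1 + q)) := by
  have e : (1 + q) ^ (-(1 / 2) : ℝ) = √(1 / (1 + q)) := by
    rw [Real.rpow_neg (by positivity), ← Real.sqrt_eq_rpow, one_div, Real.sqrt_inv]
  rw [thermalAngle, h, e, Real.cos_arccos]
  · linarith [Real.sqrt_nonneg (1 / (1 + q))]
  · rw [Real.sqrt_le_one, div_le_one (by positivity)]
    linarith

theorem sin_thermalAngle {a b q : ℝ} (hq : 0 ≤ q) (h : b / a = q) :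
    Real.sin (thermalAngle a b) = √(q / (1 + q)) := by
  have e : (1 + q) ^ (-(1 / 2) : ℝ) = √(1 / (1 + q)) := by
    rw [Real.rpow_neg (by positivity), ← Real.sqrt_eq_rpow, one_div, Real.sqrt_inv]
  rw [thermalAngle, h, e, Real.sin_arccos, Real.sq_sqrt (by positivity)]
  congr 1
  field_simp
  ring

/-- The Gibbs weights `1 / (1 + q)` and `q / (1 + q)` of a qubit with Boltzmann factor `q`. -/
noncomputable def qubitWeight (q : ℝ) : Fin 2 → ℝ := ![1 / (1 + q), q / (1 + q)]

theorem gibbsWeight_qubitEnergy (β ΔE : ℝ) :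
    gibbsWeight β (qubitEnergy ΔE) = fun c => (qubitWeight (Real.exp (-β * ΔE)) c : ℂ) := by
  funext c
  fin_cases c <;> simp [gibbsWeight, qubitEnergy, qubitWeight]

theorem dissipator_smul (r : ℝ) (V : Mat n) :
    dissipator ((r : ℂ) • V) = ((r ^ 2 : ℝ) : ℂ) • dissipator V := by
  ext1 ρ
  simp [dissipator_apply, smul_smul, Matrix.conjTranspose_smul]
  module

/-- The cosine and sine do not depend on the rung, so they factor out of the two ladder operators;
the dissipator, being quadratic, turns them into the qubit's Gibbs weights. -/
theorem ladderDissipator_gibbsVector (n : ℕ) (ΔE : ℝ) (T : ℝ≥0∞) :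
    ladderDissipator (gibbsVector (equidistant n ΔE) T) =
      (qubitWeight (Real.exp (-invTemp T * ΔE)) 0 : ℂ) • dissipator (ladderLowering n) +
      (qubitWeight (Real.exp (-invTemp T * ΔE)) 1 : ℂ) •
        dissipator (ladderLowering n).conjTranspose := by
  set q := Real.exp (-invTemp T * ΔE) with hq
  have hq0 : 0 ≤ q := (Real.exp_pos _).le
  have hp : sigmaPlus (gibbsVector (equidistant n ΔE) T) =
      ((√(1 / (1 + q)) : ℝ) : ℂ) • ladderLowering n := by
    ext i j
    simp only [sigmaPlus, ladderLowering, Matrix.of_apply, Matrix.smul_apply, smul_eq_mul]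
    split_ifs with h
    · rw [cos_thermalAngle hq0 (gibbsVector_equidistant_div ΔE T h)]
      push_cast
      ring
    · simp
  have hm : sigmaMinus (gibbsVector (equidistant n ΔE) T) =
      ((√(q / (1 + q)) : ℝ) : ℂ) • (ladderLowering n).conjTranspose := by
    ext i j
    simp only [sigmaMinus, ladderLowering, Matrix.of_apply, Matrix.smul_apply, smul_eq_mul,
      Matrix.conjTranspose_apply]
    split_ifs with h
    · rw [sin_thermalAngle hq0 (gibbsVector_equidistant_div ΔE T h)]
      rw [Complex.star_def, Complex.conj_ofReal]
      push_cast
      ring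
    · simp
  rw [ladderDissipator, hp, hm, dissipator_smul, dissipator_smul, Real.sq_sqrt (by positivity),
    Real.sq_sqrt (by positivity)]
  rfl

theorem exp_ladderDissipator_mem_closure_TO (n : ℕ) (ΔE : ℝ) (T : ℝ≥0∞) {H : Mat n}
    (hH : H.IsHermitian) (hcomm : Commute H (ladderHamiltonian n ΔE)) {t : ℝ} (ht : 0 ≤ t) :
    NormedSpace.exp (-(t : ℂ) • (Complex.I • ad H +
        ladderDissipator (gibbsVector (equidistant n ΔE) T))) ∈
      closure (TO (ladderHamiltonian n ΔE) T) := by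
  have h_one : (1 : SuperOp n) ∈
      closure (TO (ladderHamiltonian n ΔE) T) :=
    subset_closure (blockThermalSubmonoid_subset_TO _ _ (one_mem _))
  -- For `n = 0` all superoperators coincide; the limit argument needs a nontrivial matrix space.
  rcases Nat.eq_zero_or_pos n with rfl | hn
  · have : Subsingleton (SuperOp 0) :=
      ⟨fun f g => by ext1 ρ; exact Subsingleton.elim _ _⟩
    convert h_one
  -- At `t = 0` the step `√(t/N)` would vanish, outside the punctured limit; the map is then the
  -- identity.
  rcases ht.eq_or_lt with rfl | ht
  · convert h_one
    rw [← NormedSpace.exp_zero]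
    congr 1
    ext1 ρ
    simp
  have : NeZero n := ⟨hn.ne'⟩
  have hneg : ∀ G : SuperOp n, -(t : ℂ) • G = (t : ℂ) • -G := fun G => by
    ext1 ρ
    simp
  rw [hneg]
  have hZ : ((-Complex.I • H) ⊗ₖ (1 : Mat 2)).conjTranspose =
      -((-Complex.I • H) ⊗ₖ (1 : Mat 2)) := by
    rw [Matrix.conjTranspose_kronecker, Matrix.conjTranspose_smul, hH.eq]
    rw [Matrix.conjTranspose_one, Matrix.smul_kronecker, Matrix.smul_kronecker, ← neg_smul]
    simp
  have hZc : Commute (uncoupled (ladderHamiltonian n ΔE)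
      (Matrix.diagonal fun k => (qubitEnergy ΔE k : ℂ)))
      ((-Complex.I • H) ⊗ₖ (1 : Mat 2)) := by
    refine commute_uncoupled_of_bathBlock fun a c => ?_
    rw [bathBlock_kronecker]
    -- Diagonal blocks carry equal bath energies on both sides, leaving only `[H, H₀] = 0`; the
    -- others are zero.
    by_cases hac : a = c
    · simp [hac, hcomm.eq]
    · simp [hac]
  refine exp_mem_closure_of_bath (conjTranspose_qubitExchange (ladderLowering n)) hZ
    (commute_qubitExchange (ladderHamiltonian_isHermitian n ΔE)
      (ladderHamiltonian_mul_lowering n ΔE)) hZc (bathSandwich_qubitExchange_add _ _) ?_ ht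
  have hsum : ∑ c, qubitWeight (Real.exp (-invTemp T * ΔE)) c = 1 := by
    have h := sum_gibbsWeight (invTemp T) (qubitEnergy ΔE)
    rw [gibbsWeight_qubitEnergy] at h
    beta_reduce at h
    exact_mod_cast h
  rw [gibbsWeight_qubitEnergy, bathSandwich_qubitExchange_sq _ hsum _ hH rfl,
    ladderDissipator_gibbsVector]

end ThermalOps

theorem mainTheorem5 (n : ℕ) (ΔE : ℝ) (hΔE : 0 < ΔE) (T : ℝ≥0∞) (hT : 0 < T)
    (H : ThermalOps.Mat n) (hH : H.IsHermitian)
    (hcomm : Commute H (ThermalOps.ladderHamiltonian n ΔE)) (t : ℝ) (ht : 0 ≤ t) :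
    NormedSpace.exp (-(t : ℂ) • (Complex.I • ThermalOps.ad H +
        ThermalOps.ladderDissipator
          (ThermalOps.gibbsVector (ThermalOps.equidistant n ΔE) T))) ∈
      closure (ThermalOps.TO (ThermalOps.ladderHamiltonian n ΔE) T) :=
  ThermalOps.exp_ladderDissipator_mem_closure_TO n ΔE T hH hcomm ht
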